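/- Let $(E,\mathcal E,\mu)$ be a probability space, $0\le t\le 1$ and $n\in\mathbb N_0$. Let $\bar N(E)$ be the set of all finite counting measures $\xi=\sum_{i=1}^k\delta_{x_i}$ ($k\in\mathbb N_0$, $x_i\in E$) on $E$, i.e. finite point sets with multiplicity, where $\xi(x)$ denotes the multiplicity of $x$ in $\xi$, endowed with the $\sigma$-algebra generated by the maps $\xi\mapsto\xi(B)$, $B\in\mathcal E$. For $\xi,\nu\in\bar N(E)$ put $\xi\backslash\nu=\sum_{x:\,\xi(x)>0}(\xi(x)-\nu(x))_+\,\delta_x$, and for $\alpha:E\to[0,\infty)$ put $\|\alpha\|_{2,\xi}^2=\int\alpha^2\,d\xi$. For $\xi$ with $\xi(E)\le n$ and $A\subset\bar N(E)$ define the binomial convex distance $$d_T^{n}(\xi,A)=\sup_{\alpha\ge 0,\ \|\alpha\|_{2,\xi}^2\le 1}\ \inf_{\nu\in A}\Big[\int\alpha\,d(\xi\backslash\nu)+\frac{(\nu(E)-\xi(E))_+}{(n-\xi(E))^{1/2}}\,\big(1-\|\alpha\|_{2,\xi}^2\big)^{1/2}\Big]\in[0,\infty]$$ (with $\inf\emptyset=\infty$,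 $0/0=0$, $c/0=\infty$ for $c>0$, and $\infty\cdot 0=0$), and let $A_s^{n}=\{\xi:\ d_T^{n}(\xi,A)\le s\}$. Let $\xi_n$ be a binomial point process on $E$ of intensity $t\mu$ with parameter $n$, i.e. a random element of $\bar N(E)$ such that for all pairwise disjoint $B_1,\dots,B_m\in\mathcal E$ and all $k_1,\dots,k_m\in\mathbb N_0$ with $k:=k_1+\dots+k_m\le n$, $$\mathbb P(\xi_n(B_1)=k_1,\dots,\xi_n(B_m)=k_m)=\frac{n!}{k_1!\cdots k_m!\,(n-k)!}\prod_{i=1}^m(t\mu(B_i))^{k_i}\Big(1-t\sum_{i=1}^m\mu(B_i)\Big)^{n-k},$$ while this probability is $0$ if $k>n$. Then for every measurable $A\subset\bar N(E)$ and every $s\ge 0$, $$\mathbb P(\xi_n\in A)\;\mathbb P(\xi_n\notin A_s^{n})\le e^{-s^2/4},$$ where the second probability is understood as an outer probability if the event is not measurable. -/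

import Mathlib

open MeasureTheory
open scoped NNReal ENNReal

namespace PointProcess

variable {E : Type*}

/-- Finite counting measures `∑ᵢ δ_{xᵢ}` on `E`, represented as finite point sets with
multiplicity; the point mass `ξ({x})` is the multiplicity of `x` in `ξ`. -/
abbrev CountingMeasure (E : Type*) := Multiset E

open Classical in
/-- `ξ(B)`: the number of points of `ξ` in `B`, counted with multiplicity. -/
noncomputable def mass (ξ : CountingMeasure E) (B : Set E) : ℕ :=
  Multiset.countP (fun x => x ∈ B) ξ

/-- The total mass `ξ(E)`. -/
def totalMass (ξ : CountingMeasure E) : ℕ := Multiset.card ξ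

/-- The usual σ-algebra on the space of finite counting measures: the smallest one for which
all evaluations `ξ ↦ ξ(B)`, `B` measurable, are measurable. -/
noncomputable instance instMeasurableSpaceCountingMeasure [MeasurableSpace E] :
    MeasurableSpace (CountingMeasure E) :=
  ⨆ (B : Set E) (_ : MeasurableSet B), MeasurableSpace.comap (fun ξ => mass ξ B) ⊤

open Classical in
/-- `ξ \ ν = ∑_{x : ξ(x) > 0} (ξ(x) - ν(x))₊ δₓ`: subtraction of multisets truncates
multiplicities at `0`. -/
noncomputable def diff (ξ ν : CountingMeasure E) : CountingMeasure E := ξ - ν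

/-- `∫ α dξ`, that is the sum of `α` over the points of `ξ` with multiplicity. -/
def pointIntegral (α : E → ℝ≥0) (ξ : CountingMeasure E) : ℝ≥0 := (ξ.map α).sum

/-- `‖α‖²_{2,ξ} = ∫ α² dξ`. -/
def normSq (α : E → ℝ≥0) (ξ : CountingMeasure E) : ℝ≥0 := pointIntegral (fun x => α x ^ 2) ξ

/-- The binomial convex distance `d_T^n(ξ, A)`, for `ξ(E) ≤ n`: the supremum over all nonnegative
functions `α` with `‖α‖²_{2,ξ} ≤ 1` of
`inf_{ν ∈ A} [∫ α d(ξ \ ν) + (ν(E) - ξ(E))₊ / (n - ξ(E))^{1/2} * (1 - ‖α‖²_{2,ξ})^{1/2}]`.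
It takes values in `[0, ∞]`, with `inf ∅ = ∞`, `0 / 0 = 0`, `c / 0 = ∞` for `c > 0` and
`∞ * 0 = 0`. The subtractions of natural numbers are truncated at `0`. -/
noncomputable def convexDist (n : ℕ) (ξ : CountingMeasure E) (A : Set (CountingMeasure E)) :
    ℝ≥0∞ :=
  ⨆ (α : E → ℝ≥0) (_ : normSq α ξ ≤ 1), ⨅ ν ∈ A,
    ((pointIntegral α (diff ξ ν) : ℝ≥0) : ℝ≥0∞) +
      ((totalMass ν - totalMass ξ : ℕ) : ℝ≥0∞) / ((n - totalMass ξ : ℕ) : ℝ≥0∞) ^ (1 / 2 : ℝ) *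
        ((1 - normSq α ξ : ℝ≥0) : ℝ≥0∞) ^ (1 / 2 : ℝ)

/-- The parallel set `A_s^n = {ξ : d_T^n(ξ, A) ≤ s}`. -/
def parallelSet (n : ℕ) (A : Set (CountingMeasure E)) (s : ℝ) : Set (CountingMeasure E) :=
  {ξ | convexDist n ξ A ≤ ENNReal.ofReal s}

/-- `ξ` is a binomial point process on `E` of intensity `t μ` with parameter `n`: a random finite
counting measure such that, for pairwise disjoint measurable sets `B₁, …, B_m`, the vector
`(ξ(B₁), …, ξ(B_m))` has the multinomial distribution
`P(ξ(Bᵢ) = kᵢ ∀ i) = n! / (k₁! ⋯ k_m! (n - ∑ kᵢ)!) ∏ᵢ (t μ(Bᵢ))^{kᵢ} (1 - ∑ᵢ t μ(Bᵢ))^{n - ∑ kᵢ}`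
(and `0` if `∑ kᵢ > n`). For `m = 1` this is the binomial distribution with parameters `n` and
`t μ(B)`. -/
structure IsBinomialPointProcess [MeasurableSpace E] {Ω : Type*} [MeasurableSpace Ω]
    (P : Measure Ω) (ξ : Ω → CountingMeasure E) (n : ℕ) (t : ℝ) (μ : Measure E) : Prop where
  measurable : Measurable ξ
  multinomial : ∀ (m : ℕ) (B : Fin m → Set E), (∀ i, MeasurableSet (B i)) →
    (∀ i j, i ≠ j → Disjoint (B i) (B j)) → ∀ k : Fin m → ℕ,
      P.real {ω | ∀ i, mass (ξ ω) (B i) = k i} =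
        (n.choose (∑ i, k i) * Nat.multinomial Finset.univ k : ℕ) *
          (∏ i, (t * μ.real (B i)) ^ k i) * (1 - ∑ i, t * μ.real (B i)) ^ (n - ∑ i, k i)

end PointProcess

/-! A binomial process is distributed as `n` independent points, each drawn from `μ` with
probability `t` and otherwise replaced by an extra symbol (`map_eq_map_pointsOf`). The claim thus
reduces to Talagrand's convex distance inequality in a product space.

Talagrand's inequality (`lintegral_expDist_resampleSets_le`) says that `exp (d ^ 2 / 4)` has
integral at most the inverse measure of `A`, where `d` is the distance from `0` to the hull of the
coordinate sets whose resampling can lead into `A`. Induction on `n`: keeping the first coordinate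
leads to a section of `A`, resampling it leads to the projection of `A`. Mixing both options with
weight `l`, applying Hölder and optimizing over `l` closes the induction. Demanding positive
probability rather than mere possibility replaces the projection by a measurable, essential one.

The distance `d` dominates `convexDist` (`convexDist_pointsOf_le`): a weight `α` on points becomes a
unit-ball vector on coordinates, the mass `1 - ‖α‖²` being spread evenly over the extra symbols.
Markov's inequality then gives the tail bound.

Since the complement of the parallel set need not be measurable, equality in law cannot be applied
to it directly. It is enclosed in a measurable event by examining all `orderings` of a point set. -/

namespace ConvexDistance

/-- Replace the coordinates of `x` marked by `z` with those of `y`. -/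
def mix {X : Type*} {n : ℕ} (z : Fin n → Bool) (x y : Fin n → X) : Fin n → X :=
  fun i => if z i then y i else x i

/-- The sets of coordinates of `x` that can be resampled so that the result lies in `A` with
positive probability. -/
def resampleSets {X : Type*} [MeasurableSpace X] {n : ℕ} (ρ : Measure X) (A : Set (Fin n → X))
    (x : Fin n → X) : Set (Fin n → Bool) :=
  {z | Measure.pi (fun _ => ρ) {y | mix z x y ∈ A} ≠ 0}

/-- The indicator vector of a set of coordinates. -/
def indicatorVec {n : ℕ} (z : Fin n → Bool) : Fin n → ℝ := fun i => if z i then 1 else 0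

/-- The convex hull of the indicator vectors of a family of sets of coordinates. -/
def indicatorHull {n : ℕ} (U : Set (Fin n → Bool)) : Set (Fin n → ℝ) :=
  convexHull ℝ (indicatorVec '' U)

/-- `exp (d ^ 2 / 4)` for the Euclidean distance `d` from `0` to `indicatorHull U`. -/
noncomputable def expDist {n : ℕ} (U : Set (Fin n → Bool)) : ℝ≥0∞ :=
  ⨅ z ∈ indicatorHull U, ENNReal.ofReal (Real.exp ((∑ i, z i ^ 2) / 4))

/-! ### Scalar inequalities for the induction step. -/

/-- The left side is `2 exp (-u²/2) cosh v` with `v = u - u²/2`. Now use `cosh v ≤ exp (v²/2)` and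
`0 ≤ v ≤ u`. -/
lemma exp_sub_sq_add_exp_neg_le {u : ℝ} (h0 : 0 ≤ u) (h1 : u ≤ 1 / 2) :
    Real.exp (u - u ^ 2) + Real.exp (-u) ≤ 2 := by
  have h := Real.cosh_le_exp_half_sq (u - u ^ 2 / 2)
  rw [Real.cosh_eq] at h
  have e1 : Real.exp (u - u ^ 2) = Real.exp (-(u ^ 2 / 2)) * Real.exp (u - u ^ 2 / 2) := by
    rw [← Real.exp_add]; ring_nf
  have e2 : Real.exp (-u) = Real.exp (-(u ^ 2 / 2)) * Real.exp (-(u - u ^ 2 / 2)) := by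
    rw [← Real.exp_add]; ring_nf
  have e3 : Real.exp (-(u ^ 2 / 2)) * Real.exp ((u - u ^ 2 / 2) ^ 2 / 2) ≤ 1 := by
    rw [← Real.exp_add, Real.exp_le_one_iff]
    have : 0 ≤ u - u ^ 2 / 2 := by nlinarith
    nlinarith [sq_nonneg u]
  have hp := Real.exp_pos (-(u ^ 2 / 2))
  rw [e1, e2]
  nlinarith [mul_le_mul_of_nonneg_left h hp.le]

/-- Optimizing the exponent in the induction step of Talagrand's inequality. -/
lemma exists_exponent {r : ℝ} (h0 : 0 < r) (h1 : r ≤ 1) :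
    ∃ l : ℝ, 0 ≤ l ∧ l ≤ 1 ∧ Real.exp ((1 - l) ^ 2 / 4) * r ^ (-l) ≤ 2 - r := by
  have hlog : Real.log r ≤ 0 := Real.log_nonpos h0.le h1
  by_cases h : -(1 / 2) ≤ Real.log r
  -- This is the critical point of `(1 - l)² / 4 - l log r`; it is nonnegative exactly in this case.
  · refine ⟨1 + 2 * Real.log r, by linarith, by linarith, ?_⟩
    have h2 := exp_sub_sq_add_exp_neg_le (u := -Real.log r) (by linarith) (by linarith)
    rw [neg_neg, Real.exp_log h0] at h2
    rw [Real.rpow_def_of_pos h0, ← Real.exp_add]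
    have : (1 - (1 + 2 * Real.log r)) ^ 2 / 4 + Real.log r * -(1 + 2 * Real.log r)
      = -Real.log r - (-Real.log r) ^ 2 := by ring
    rw [this]; linarith
  · push Not at h
    refine ⟨0, le_rfl, zero_le_one, ?_⟩
    have h2 := exp_sub_sq_add_exp_neg_le (u := 1 / 2) (by norm_num) le_rfl
    have h3 : r ≤ Real.exp (-(1 / 2)) := by
      rw [← Real.log_le_iff_le_exp h0]; exact h.le
    norm_num at h2 h3 ⊢
    linarith

/-! ### Convex hulls of indicators under adding one coordinate. -/

lemma cons_mem_indicatorHull {n : ℕ} {b : Bool} {U : Set (Fin (n + 1) → Bool)}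
    {V : Set (Fin n → Bool)} (hV : ∀ z ∈ V, Fin.cons b z ∈ U) {v : Fin n → ℝ}
    (hv : v ∈ indicatorHull V) :
    (Fin.cons (if b then 1 else 0) v : Fin (n + 1) → ℝ) ∈ indicatorHull U := by
  have : Convex ℝ {v : Fin n → ℝ |
      (Fin.cons (if b then 1 else 0) v : Fin (n + 1) → ℝ) ∈ indicatorHull U} := by
    intro p hp q hq a c ha hc hac
    have := (convex_convexHull ℝ (indicatorVec '' U)) hp hq ha hc hac
    rw [Set.mem_ofPred_eq, indicatorHull]
    convert this using 1
    funext i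
    refine Fin.cases ?_ (fun j => ?_) i
    · simp only [Fin.cons_zero, Pi.add_apply, Pi.smul_apply, smul_eq_mul, ← add_mul, hac, one_mul]
    · simp
  refine convexHull_min ?_ this hv
  rintro _ ⟨u, hu, rfl⟩
  refine subset_convexHull ℝ _ ⟨_, hV u hu, ?_⟩
  funext i
  refine Fin.cases ?_ (fun j => ?_) i <;> simp [indicatorVec]

lemma indicatorHull_cons_combo {n : ℕ} {U : Set (Fin (n + 1) → Bool)} {U₀ U₁ : Set (Fin n → Bool)}
    (h0 : ∀ z ∈ U₀, Fin.cons false z ∈ U) (h1 : ∀ z ∈ U₁, Fin.cons true z ∈ U)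
    {l : ℝ} (hl0 : 0 ≤ l) (hl1 : l ≤ 1) {z w : Fin n → ℝ}
    (hz : z ∈ indicatorHull U₀) (hw : w ∈ indicatorHull U₁) :
    (Fin.cons (1 - l) (l • z + (1 - l) • w) : Fin (n + 1) → ℝ) ∈ indicatorHull U := by
  have := (convex_convexHull ℝ (indicatorVec '' U)) (cons_mem_indicatorHull h0 hz)
    (cons_mem_indicatorHull h1 hw) hl0 (sub_nonneg.2 hl1) (by ring)
  rw [indicatorHull]
  convert this using 1
  funext i
  refine Fin.cases ?_ (fun j => ?_) i <;> simp

lemma sum_sq_cons_combo_le {n : ℕ} {l : ℝ} (hl0 : 0 ≤ l) (hl1 : l ≤ 1) (z w : Fin n → ℝ) :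
    ∑ i, (Fin.cons (1 - l) (l • z + (1 - l) • w) : Fin (n + 1) → ℝ) i ^ 2 ≤
      (1 - l) ^ 2 + l * ∑ i, z i ^ 2 + (1 - l) * ∑ i, w i ^ 2 := by
  rw [Fin.sum_univ_succ, Finset.mul_sum, Finset.mul_sum, add_assoc, ← Finset.sum_add_distrib]
  simp only [Fin.cons_zero, Fin.cons_succ, Pi.add_apply, Pi.smul_apply, smul_eq_mul]
  gcongr with i
  nlinarith [mul_nonneg (mul_nonneg hl0 (sub_nonneg.2 hl1)) (sq_nonneg (z i - w i))]

lemma expDist_le {n : ℕ} {U : Set (Fin n → Bool)} {z : Fin n → ℝ} (hz : z ∈ indicatorHull U) :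
    expDist U ≤ ENNReal.ofReal (Real.exp ((∑ i, z i ^ 2) / 4)) :=
  iInf₂_le _ hz

lemma expDist_cons_true_le {n : ℕ} {U : Set (Fin (n + 1) → Bool)} {U₁ : Set (Fin n → Bool)}
    (h1 : ∀ z ∈ U₁, Fin.cons true z ∈ U) :
    expDist U ≤ ENNReal.ofReal (Real.exp (1 / 4)) * expDist U₁ := by
  rw [expDist.eq_def U₁, ENNReal.mul_iInf_of_ne (by simp [Real.exp_pos]) (by simp)]
  refine le_iInf fun w => ?_
  rw [ENNReal.mul_iInf_of_ne (by simp [Real.exp_pos]) (by simp)]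
  refine le_iInf fun hw => (expDist_le (cons_mem_indicatorHull h1 hw)).trans ?_
  rw [← ENNReal.ofReal_mul (Real.exp_pos _).le, ← Real.exp_add]
  refine ENNReal.ofReal_le_ofReal (Real.exp_le_exp.2 ?_)
  simp [Fin.sum_univ_succ]
  linarith

lemma expDist_cons_false_le {n : ℕ} {U : Set (Fin (n + 1) → Bool)} {U₀ : Set (Fin n → Bool)}
    (h0 : ∀ z ∈ U₀, Fin.cons false z ∈ U) :
    expDist U ≤ expDist U₀ := by
  refine le_iInf₂ fun w hw => (expDist_le (cons_mem_indicatorHull h0 hw)).trans ?_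
  simp [Fin.sum_univ_succ]

lemma expDist_eq_top_or_attained {n : ℕ} (U : Set (Fin n → Bool)) :
    expDist U = ⊤ ∨ ∃ z ∈ indicatorHull U,
      expDist U = ENNReal.ofReal (Real.exp ((∑ i, z i ^ 2) / 4)) := by
  rcases (indicatorHull U).eq_empty_or_nonempty with h | h
  · left; simp [expDist, h]
  · right
    have hc : IsCompact (indicatorHull U) := (Set.toFinite (indicatorVec '' U)).isCompact_convexHull ℝ
    obtain ⟨z, hz, hmin⟩ := hc.exists_isMinOn h
      (f := fun z : Fin n → ℝ => ENNReal.ofReal (Real.exp ((∑ i, z i ^ 2) / 4)))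
      (ENNReal.continuous_ofReal.comp (by fun_prop)).continuousOn
    exact ⟨z, hz, le_antisymm (expDist_le hz) (le_iInf₂ fun w hw => hmin hw)⟩

lemma one_le_expDist {n : ℕ} (U : Set (Fin n → Bool)) : 1 ≤ expDist U := by
  refine le_iInf₂ fun z _ => ?_
  rw [ENNReal.one_le_ofReal, Real.one_le_exp_iff]
  positivity

/-- Combine minimizers for `U₀` and `U₁` with weights `l` and `1 - l`: the new coordinate costs `(1
- l)²`, the others are bounded by convexity of the square. The endpoints are separate because `⊤ ^ 0
= 1`, so an empty hull there does not make the bound trivial. -/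
lemma expDist_cons_le {n : ℕ} {U : Set (Fin (n + 1) → Bool)} {U₀ U₁ : Set (Fin n → Bool)}
    (h0 : ∀ z ∈ U₀, Fin.cons false z ∈ U) (h1 : ∀ z ∈ U₁, Fin.cons true z ∈ U)
    {l : ℝ} (hl0 : 0 ≤ l) (hl1 : l ≤ 1) :
    expDist U ≤ ENNReal.ofReal (Real.exp ((1 - l) ^ 2 / 4)) *
      (expDist U₀ ^ l * expDist U₁ ^ (1 - l)) := by
  rcases hl0.eq_or_lt with rfl | hl0
  · simpa using expDist_cons_true_le h1
  rcases hl1.eq_or_lt with rfl | hl1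
  · simpa using expDist_cons_false_le h0
  have hl2 : 0 < 1 - l := sub_pos.2 hl1
  have hc : ENNReal.ofReal (Real.exp ((1 - l) ^ 2 / 4)) ≠ 0 := by simp [Real.exp_pos]
  have hpos : ∀ (V : Set (Fin n → Bool)) (p : ℝ), 0 < p → expDist V ^ p ≠ 0 := fun V p hp =>
    (zero_lt_one.trans_le (ENNReal.one_le_rpow (one_le_expDist V) hp)).ne'
  rcases expDist_eq_top_or_attained U₀ with hz | ⟨z, hz, hze⟩
  · rw [hz, ENNReal.top_rpow_of_pos hl0, ENNReal.top_mul (hpos _ _ hl2), ENNReal.mul_top hc]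
    exact le_top
  rcases expDist_eq_top_or_attained U₁ with hw | ⟨w, hw, hwe⟩
  · rw [hw, ENNReal.top_rpow_of_pos hl2, ENNReal.mul_top (hpos _ _ hl0), ENNReal.mul_top hc]
    exact le_top
  refine (expDist_le (indicatorHull_cons_combo h0 h1 hl0.le hl1.le hz hw)).trans ?_
  rw [hze, hwe, ENNReal.ofReal_rpow_of_pos (Real.exp_pos _),
    ENNReal.ofReal_rpow_of_pos (Real.exp_pos _), ← Real.exp_mul, ← Real.exp_mul,
    ← ENNReal.ofReal_mul (Real.exp_pos _).le, ← ENNReal.ofReal_mul (Real.exp_pos _).le,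
    ← Real.exp_add, ← Real.exp_add]
  refine ENNReal.ofReal_le_ofReal (Real.exp_le_exp.2 ?_)
  have := sum_sq_cons_combo_le hl0.le hl1.le z w
  linarith

lemma mix_cons {X : Type*} {n : ℕ} (b : Bool) (z : Fin n → Bool) (a c : X) (x y : Fin n → X) :
    mix (Fin.cons b z) (Fin.cons a x) (Fin.cons c y) =
      (Fin.cons (if b then c else a) (mix z x y) : Fin (n + 1) → X) := by
  funext i
  refine Fin.cases ?_ (fun j => ?_) i <;> simp [mix]

/-! ### Talagrand's inequality by induction on the dimension. -/

section Measure

variable {X : Type*} [MeasurableSpace X] (ρ : Measure X) [IsProbabilityMeasure ρ]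

lemma measurable_fin_cons {n : ℕ} :
    Measurable fun p : X × (Fin n → X) => (Fin.cons p.1 p.2 : Fin (n + 1) → X) := by
  rw [measurable_pi_iff]
  refine Fin.cases ?_ fun j => ?_
  · simpa using measurable_fst
  · simpa using! (measurable_pi_apply j).comp measurable_snd

lemma lintegral_pi_succ {n : ℕ} {f : (Fin (n + 1) → X) → ℝ≥0∞} (hf : Measurable f) :
    ∫⁻ x, f x ∂(Measure.pi fun _ => ρ) =
      ∫⁻ a, ∫⁻ x, f (Fin.cons a x) ∂(Measure.pi fun _ => ρ) ∂ρ := by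
  have h := (measurePreserving_piFinSuccAbove (fun _ : Fin (n + 1) => ρ) 0).symm
  rw [← h.lintegral_comp hf, lintegral_prod _ (by fun_prop)]
  refine lintegral_congr fun a => lintegral_congr fun x => ?_
  simp [MeasurableEquiv.piFinSuccAbove, Fin.insertNthEquiv]

lemma pi_succ_apply {n : ℕ} {A : Set (Fin (n + 1) → X)} (hA : MeasurableSet A) :
    Measure.pi (fun _ => ρ) A =
      ∫⁻ a, Measure.pi (fun _ => ρ) {x : Fin n → X | Fin.cons a x ∈ A} ∂ρ := by
  rw [← lintegral_indicator_one hA, lintegral_pi_succ ρ (measurable_one.indicator hA)]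
  refine lintegral_congr fun a => ?_
  rw [← lintegral_indicator_one]
  · rfl
  · exact (measurable_fin_cons.comp measurable_prodMk_left) hA

lemma pi_succ_apply_symm {n : ℕ} {A : Set (Fin (n + 1) → X)} (hA : MeasurableSet A) :
    Measure.pi (fun _ => ρ) A =
      ∫⁻ x : Fin n → X, ρ {a | Fin.cons a x ∈ A} ∂(Measure.pi fun _ => ρ) := by
  rw [← lintegral_indicator_one hA, lintegral_pi_succ ρ (measurable_one.indicator hA),
    lintegral_lintegral_swap]
  · refine lintegral_congr fun x => ?_
    rw [← lintegral_indicator_one]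
    · rfl
    · exact (measurable_fin_cons.comp measurable_prodMk_right) hA
  · exact ((measurable_one.indicator hA).comp measurable_fin_cons).aemeasurable

lemma measurable_mix {n : ℕ} (z : Fin n → Bool) :
    Measurable fun p : (Fin n → X) × (Fin n → X) => mix z p.1 p.2 := by
  rw [measurable_pi_iff]
  intro i
  unfold mix
  split_ifs <;> fun_prop

lemma measurable_resampleSets {n : ℕ} {A : Set (Fin n → X)} (hA : MeasurableSet A) :
    Measurable[_, ⊤] (resampleSets ρ A) := by
  let _ : MeasurableSpace (Set (Fin n → Bool)) := ⊤
  refine measurable_to_countable' fun U => ?_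
  have : resampleSets ρ A ⁻¹' {U} = ⋂ z, {x | z ∈ resampleSets ρ A x ↔ z ∈ U} := by
    ext x
    simp [Set.ext_iff]
  rw [this]
  refine MeasurableSet.iInter fun z => ?_
  have hm : MeasurableSet {x | z ∈ resampleSets ρ A x} := by
    have := measurable_measure_prodMk_left (ν := Measure.pi fun _ => ρ) (measurable_mix z hA)
    exact (this (measurableSet_singleton 0)).compl
  by_cases hz : z ∈ U
  · simpa only [hz, iff_true] using hm
  · simpa only [hz, iff_false] using! hm.compl

lemma measurable_expDist_resampleSets {n : ℕ} {A : Set (Fin n → X)} (hA : MeasurableSet A) :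
    Measurable fun x => expDist (resampleSets ρ A x) :=
  (measurable_from_top (f := expDist)).comp (measurable_resampleSets ρ hA)

lemma measurable_pi_section {n : ℕ} {A : Set (Fin (n + 1) → X)} (hA : MeasurableSet A) :
    Measurable fun a => Measure.pi (fun _ => ρ) {x : Fin n → X | Fin.cons a x ∈ A} :=
  measurable_measure_prodMk_left (measurable_fin_cons hA)

lemma measurable_measure_section {n : ℕ} {A : Set (Fin (n + 1) → X)} (hA : MeasurableSet A) :
    Measurable fun x : Fin n → X => ρ {a | Fin.cons a x ∈ A} :=
  measurable_measure_prodMk_right (measurable_fin_cons hA)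

lemma cons_false_mem_resampleSets {n : ℕ} {A : Set (Fin (n + 1) → X)} (hA : MeasurableSet A)
    {a : X} {x : Fin n → X} {z : Fin n → Bool}
    (hz : z ∈ resampleSets ρ {x | Fin.cons a x ∈ A} x) :
    Fin.cons false z ∈ resampleSets ρ A (Fin.cons a x) := by
  rw [resampleSets, Set.mem_ofPred_eq] at hz ⊢
  have hm : MeasurableSet {y | mix (Fin.cons false z) (Fin.cons a x) y ∈ A} :=
    (measurable_mix _).comp measurable_prodMk_left hA
  rw [pi_succ_apply ρ hm]
  simpa [mix_cons] using hz

lemma cons_true_mem_resampleSets {n : ℕ} {A : Set (Fin (n + 1) → X)} (hA : MeasurableSet A)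
    {a : X} {x : Fin n → X} {z : Fin n → Bool}
    (hz : z ∈ resampleSets ρ {x | ρ {a | Fin.cons a x ∈ A} ≠ 0} x) :
    Fin.cons true z ∈ resampleSets ρ A (Fin.cons a x) := by
  rw [resampleSets, Set.mem_ofPred_eq] at hz ⊢
  have hmA : MeasurableSet {y | mix (Fin.cons true z) (Fin.cons a x) y ∈ A} :=
    (measurable_mix _).comp measurable_prodMk_left hA
  rw [pi_succ_apply_symm ρ hmA]
  contrapose! hz
  have hm : Measurable fun y : Fin n → X => ρ {c | Fin.cons c (mix z x y) ∈ A} :=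
    (measurable_measure_section ρ hA).comp ((measurable_mix z).comp measurable_prodMk_left)
  simp only [Set.mem_ofPred_eq, mix_cons, if_true] at hz
  exact (lintegral_eq_zero_iff hm).1 hz

/-- The part of `A` lying over the complement of the essential projection is null when the first
coordinate is integrated first. By Fubini almost all of its sections are null as well. -/
lemma ae_section_le {n : ℕ} {A : Set (Fin (n + 1) → X)} (hA : MeasurableSet A) :
    ∀ᵐ a ∂ρ, Measure.pi (fun _ => ρ) {x : Fin n → X | Fin.cons a x ∈ A} ≤
      Measure.pi (fun _ => ρ) {x : Fin n → X | ρ {a | Fin.cons a x ∈ A} ≠ 0} := by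
  set B := {x : Fin n → X | ρ {a | Fin.cons a x ∈ A} ≠ 0} with hB
  have hBm : MeasurableSet B :=
    (measurable_measure_section ρ hA (measurableSet_singleton 0)).compl
  have hm : MeasurableSet (A ∩ Fin.tail ⁻¹' Bᶜ) :=
    hA.inter ((measurable_pi_iff.2 fun i => measurable_pi_apply i.succ) hBm.compl)
  have h0 : Measure.pi (fun _ => ρ) (A ∩ Fin.tail ⁻¹' Bᶜ) = 0 := by
    rw [pi_succ_apply_symm ρ hm, lintegral_eq_zero_iff (measurable_measure_section ρ hm)]
    refine Filter.Eventually.of_forall fun x => ?_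
    by_cases hx : x ∈ B
    · simp [hx]
    · have hx' : ρ {a | Fin.cons a x ∈ A} = 0 := by_contra fun h => hx h
      refine measure_mono_null (fun a ha => ?_) hx'
      exact ha.1
  rw [pi_succ_apply ρ hm, lintegral_eq_zero_iff (measurable_pi_section ρ hm)] at h0
  filter_upwards [h0] with a ha
  have ha' : Measure.pi (fun _ => ρ) ({x : Fin n → X | Fin.cons a x ∈ A} \ B) = 0 := by
    simpa using! ha
  exact measure_mono_ae (ae_le_set.2 ha')

/-- Exponential integrability of the convex distance to a set of a product probability space. -/
theorem lintegral_expDist_resampleSets_le {n : ℕ} {A : Set (Fin n → X)} (hA : MeasurableSet A) :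
    ∫⁻ x, expDist (resampleSets ρ A x) ∂(Measure.pi fun _ => ρ) ≤
      (Measure.pi (fun _ => ρ) A)⁻¹ := by
  induction n with
  | zero =>
    rcases A.eq_empty_or_nonempty with rfl | hne
    · simp
    · obtain rfl : A = Set.univ := Set.eq_univ_of_univ_subset fun x _ => by
        obtain ⟨y, hy⟩ := hne
        rwa [Subsingleton.elim x y]
      have : ∀ x : Fin 0 → X, expDist (resampleSets ρ Set.univ x) ≤ 1 := fun x => by
        have : (0 : Fin 0 → ℝ) ∈ indicatorHull (resampleSets ρ Set.univ x) :=
          subset_convexHull ℝ _ ⟨Fin.elim0, by simp [resampleSets], Subsingleton.elim _ _⟩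
        simpa using expDist_le this
      calc _ ≤ ∫⁻ x : Fin 0 → X, 1 ∂(Measure.pi fun _ => ρ) := lintegral_mono this
        _ ≤ _ := by simp
  | succ n ih =>
    set P := Measure.pi (fun _ : Fin n => ρ) with hP
    set B := {x : Fin n → X | ρ {a | Fin.cons a x ∈ A} ≠ 0} with hB
    have hBm : MeasurableSet B :=
      (measurable_measure_section ρ hA (measurableSet_singleton 0)).compl
    have hAm : ∀ a, MeasurableSet {x : Fin n → X | Fin.cons a x ∈ A} := fun a =>
      (measurable_fin_cons.comp measurable_prodMk_left) hA
    have hsec := ae_section_le ρ hA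
    rw [← hB, ← hP] at hsec
    have hpA := pi_succ_apply ρ hA
    have hsecm : Measurable fun a => P {x : Fin n → X | Fin.cons a x ∈ A} :=
      measurable_pi_section ρ hA
    by_cases hA0 : Measure.pi (fun _ => ρ) A = 0
    · simp [hA0]
    have hAB : Measure.pi (fun _ => ρ) A ≤ P B := by
      rw [hpA]
      exact (lintegral_mono_ae hsec).trans (by simp)
    have hb : 0 < P.real B :=
      ENNReal.toReal_pos (fun h => hA0 (le_antisymm (h ▸ hAB) bot_le)) (measure_ne_top _ _)
    have hbe : P B = ENNReal.ofReal (P.real B) := by simp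
    have hbound : ∀ᵐ a ∂ρ, ∫⁻ x, expDist (resampleSets ρ A (Fin.cons a x)) ∂P ≤
        ENNReal.ofReal ((2 - P.real {x : Fin n → X | Fin.cons a x ∈ A} / P.real B) / P.real B) := by
      filter_upwards [hsec] with a ha
      have hrec : ∀ l : ℝ, 0 ≤ l → l ≤ 1 → ∫⁻ x, expDist (resampleSets ρ A (Fin.cons a x)) ∂P ≤
          ENNReal.ofReal (Real.exp ((1 - l) ^ 2 / 4)) *
            ((P {x : Fin n → X | Fin.cons a x ∈ A})⁻¹ ^ l * (P B)⁻¹ ^ (1 - l)) := by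
        intro l hl0 hl1
        calc _ ≤ ∫⁻ x, ENNReal.ofReal (Real.exp ((1 - l) ^ 2 / 4)) *
              (expDist (resampleSets ρ {x | Fin.cons a x ∈ A} x) ^ l *
                expDist (resampleSets ρ B x) ^ (1 - l)) ∂P :=
              lintegral_mono fun x => expDist_cons_le
                (fun z hz => cons_false_mem_resampleSets ρ hA hz)
                (fun z hz => cons_true_mem_resampleSets ρ hA hz) hl0 hl1
          _ ≤ _ := by
            rw [lintegral_const_mul' _ _ ENNReal.ofReal_ne_top]
            refine mul_le_mul_right ?_ _
            -- Hölder with exponents `1 / l` and `1 / (1 - l)`.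
            refine (ENNReal.lintegral_mul_norm_pow_le
              (measurable_expDist_resampleSets ρ (hAm a)).aemeasurable
              (measurable_expDist_resampleSets ρ hBm).aemeasurable hl0 (sub_nonneg.2 hl1)
              (by ring)).trans ?_
            have := sub_nonneg.2 hl1
            gcongr
            · exact ih (hAm a)
            · exact ih hBm
      set p := P.real {x : Fin n → X | Fin.cons a x ∈ A} with hp
      have hpe : P {x : Fin n → X | Fin.cons a x ∈ A} = ENNReal.ofReal p := by simp [hp]
      have hp0 : 0 ≤ p := measureReal_nonneg
      rcases hp0.eq_or_lt with hp0 | hp0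
      -- A null section gives no information, so only resampling is used; `exp (1 / 4) ≤ 2`
      -- suffices.
      · refine (hrec 0 le_rfl zero_le_one).trans ?_
        rw [← hp0, hbe, ← ENNReal.ofReal_inv_of_pos hb]
        have := exp_sub_sq_add_exp_neg_le (u := 1 / 2) (by norm_num) le_rfl
        simp only [sub_zero, ENNReal.rpow_zero, ENNReal.rpow_one, one_mul, zero_div]
        rw [← ENNReal.ofReal_mul (Real.exp_pos _).le, div_eq_mul_inv]
        refine ENNReal.ofReal_le_ofReal ?_
        refine mul_le_mul_of_nonneg_right ?_ (inv_nonneg.2 hb.le)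
        norm_num at this ⊢
        linarith [Real.exp_pos (-(1 / 2))]
      · have hpb : p ≤ P.real B := ENNReal.toReal_mono (measure_ne_top _ _) ha
        obtain ⟨l, hl0, hl1, hl⟩ := exists_exponent (div_pos hp0 hb) ((div_le_one hb).2 hpb)
        refine (hrec l hl0 hl1).trans ?_
        rw [hpe, hbe, ← ENNReal.ofReal_inv_of_pos hb, ← ENNReal.ofReal_inv_of_pos hp0,
          ENNReal.ofReal_rpow_of_pos (inv_pos.2 hp0), ENNReal.ofReal_rpow_of_pos (inv_pos.2 hb),
          ← ENNReal.ofReal_mul (by positivity), ← ENNReal.ofReal_mul (by positivity)]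
        refine ENNReal.ofReal_le_ofReal ?_
        refine le_trans (le_of_eq ?_) (div_le_div_of_nonneg_right hl hb.le)
        rw [Real.inv_rpow hp0.le, Real.inv_rpow hb.le, Real.div_rpow hp0.le hb.le,
          Real.rpow_neg hp0.le, Real.rpow_neg hb.le, Real.rpow_sub hb, Real.rpow_one]
        field_simp
    rw [lintegral_pi_succ ρ (measurable_expDist_resampleSets ρ hA)]
    refine (lintegral_mono_ae hbound).trans ?_
    have hint : Integrable (fun a => P.real {x : Fin n → X | Fin.cons a x ∈ A}) ρ :=
      Integrable.of_bound hsecm.ennreal_toReal.aestronglyMeasurable 1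
        (Filter.Eventually.of_forall fun a => by
          rw [Real.norm_of_nonneg measureReal_nonneg]
          exact measureReal_le_one)
    have hpAr : ∫ a, P.real {x : Fin n → X | Fin.cons a x ∈ A} ∂ρ =
        (Measure.pi (fun _ => ρ)).real A := by
      rw [measureReal_def, hpA]
      exact integral_toReal hsecm.aemeasurable
        (Filter.Eventually.of_forall fun a => measure_lt_top _ _)
    rw [← ofReal_integral_eq_lintegral_ofReal]
    · rw [integral_div, integral_sub (integrable_const _) (hint.div_const _), integral_div, hpAr]
      have hq : 0 < (Measure.pi (fun _ => ρ)).real A :=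
        ENNReal.toReal_pos hA0 (measure_ne_top _ _)
      have : Measure.pi (fun _ => ρ) A = ENNReal.ofReal ((Measure.pi (fun _ => ρ)).real A) := by
        simp
      rw [this, ← ENNReal.ofReal_inv_of_pos hq]
      refine ENNReal.ofReal_le_ofReal ?_
      set q := (Measure.pi (fun _ => ρ)).real A
      simp only [integral_const, probReal_univ, smul_eq_mul, one_mul]
      rw [div_le_iff₀ hb, ← sub_nonneg]
      -- With `x = q / P.real B`, this is `2 - x ≤ 1 / x`.
      have : q⁻¹ * P.real B - (2 - q / P.real B) = (P.real B - q) ^ 2 / (q * P.real B) := by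
        field_simp
        ring
      rw [this]
      positivity
    · exact (((integrable_const _).sub (hint.div_const _)).div_const _)
    · filter_upwards [hsec] with a ha
      have : P.real {x : Fin n → X | Fin.cons a x ∈ A} / P.real B ≤ 1 :=
        (div_le_one hb).2 (ENNReal.toReal_mono (measure_ne_top _ _) ha)
      exact div_nonneg (by linarith) hb.le

end Measure

end ConvexDistance

/-! ### Comparison of the two convex distances. -/

namespace ConvexDistance

open PointProcess

/-- The point set formed by the coordinates of `x` that lie in `E`. -/
def pointsOf {E : Type*} {n : ℕ} (x : Fin n → E ⊕ Unit) : CountingMeasure E :=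
  ∑ i, Sum.elim (fun e => {e}) (fun _ => 0) (x i)

lemma pointIntegral_pointsOf {E : Type*} {n : ℕ} (x : Fin n → E ⊕ Unit) (f : E → ℝ≥0) :
    pointIntegral f (pointsOf x) = ∑ i, Sum.elim f (fun _ => 0) (x i) := by
  let g : Multiset E →+ ℝ≥0 :=
    { toFun := fun ξ => (ξ.map f).sum, map_zero' := by simp, map_add' := by simp }
  change g (pointsOf x) = _
  rw [pointsOf, map_sum]
  refine Finset.sum_congr rfl fun i _ => ?_
  cases x i with
  | inl e => exact (congrArg Multiset.sum (Multiset.map_singleton f e)).trans (by simp)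
  | inr _ => simp

lemma totalMass_pointsOf {E : Type*} {n : ℕ} (x : Fin n → E ⊕ Unit) :
    totalMass (pointsOf x) = ∑ i, Sum.elim (fun _ => 1) (fun _ => 0) (x i) := by
  rw [totalMass, pointsOf, Multiset.card_sum]
  refine Finset.sum_congr rfl fun i _ => ?_
  cases x i <;> simp

lemma totalMass_pointsOf_add {E : Type*} {n : ℕ} (x : Fin n → E ⊕ Unit) :
    totalMass (pointsOf x) + ∑ i, Sum.elim (fun _ => 0) (fun _ => 1) (x i) = n := by
  rw [totalMass_pointsOf, ← Finset.sum_add_distrib]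
  refine Eq.trans (Finset.sum_congr rfl (g := fun _ => 1) fun i _ => ?_) (by simp)
  cases x i <;> simp

lemma pointIntegral_mono {E : Type*} (f : E → ℝ≥0) {ξ ν : CountingMeasure E} (h : ξ ≤ ν) :
    pointIntegral f ξ ≤ pointIntegral f ν := by
  obtain ⟨η, rfl⟩ := Multiset.le_iff_exists_add.1 h
  simp [pointIntegral]

/-- Only overwritten points can be missing after the mixing. -/
lemma pointIntegral_diff_mix_le {E : Type*} {n : ℕ} (f : E → ℝ≥0) (u : Fin n → Bool)
    (x y : Fin n → E ⊕ Unit) :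
    pointIntegral f (diff (pointsOf x) (pointsOf (mix u x y))) ≤
      ∑ i, if u i then Sum.elim f (fun _ => 0) (x i) else 0 := by
  classical
  set w : Fin n → E ⊕ Unit := fun i => if u i then x i else Sum.inr () with hw
  have h1 : diff (pointsOf x) (pointsOf (mix u x y)) ≤ pointsOf w := by
    rw [diff]
    refine tsub_le_iff_left.2 ?_
    rw [pointsOf, pointsOf, pointsOf, ← Finset.sum_add_distrib]
    refine Finset.sum_le_sum fun i _ => ?_
    by_cases hu : u i <;> simp [mix, hw, hu]
  refine (pointIntegral_mono f h1).trans ?_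
  rw [pointIntegral_pointsOf]
  refine Finset.sum_le_sum fun i _ => ?_
  by_cases hu : u i <;> simp [hw, hu]

lemma totalMass_mix_sub_le {E : Type*} {n : ℕ} (u : Fin n → Bool) (x y : Fin n → E ⊕ Unit) :
    totalMass (pointsOf (mix u x y)) - totalMass (pointsOf x) ≤
      ∑ i, if u i then Sum.elim (fun _ => 0) (fun _ => 1) (x i) else 0 := by
  refine tsub_le_iff_left.2 ?_
  rw [totalMass_pointsOf, totalMass_pointsOf, ← Finset.sum_add_distrib]
  refine Finset.sum_le_sum fun i _ => ?_
  by_cases hu : u i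
  · cases hx : x i <;> cases hy : y i <;> simp [mix, hu, hy]
  · simp [mix, hu]

/-- Otherwise all vertices, hence the whole hull, would lie in an open half-space that excludes `z`.
-/
lemma exists_mem_sum_le_of_mem_indicatorHull {n : ℕ} {U : Set (Fin n → Bool)} {z : Fin n → ℝ}
    (hz : z ∈ indicatorHull U) (a : Fin n → ℝ) :
    ∃ u ∈ U, (∑ i, if u i then a i else 0) ≤ ∑ i, a i * z i := by
  by_contra! h
  have hlin : IsLinearMap ℝ fun w : Fin n → ℝ => ∑ i, a i * w i :=
    ⟨fun v w => by simp [mul_add, Finset.sum_add_distrib],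
      fun c w => by simp [Finset.mul_sum, mul_left_comm]⟩
  have := convexHull_min (s := indicatorVec '' U) ?_
    (convex_halfSpace_gt hlin (∑ i, a i * z i)) hz
  · simp at this
  · rintro _ ⟨u, hu, rfl⟩
    simpa [indicatorVec] using h u hu

/-- The binomial convex distance is dominated by the convex distance in the product space. -/
lemma convexDist_pointsOf_le {E : Type*} [MeasurableSpace E] {n : ℕ} (ρ : Measure (E ⊕ Unit))
    (A : Set (CountingMeasure E)) (x : Fin n → E ⊕ Unit) {z : Fin n → ℝ}
    (hz : z ∈ indicatorHull (resampleSets ρ (pointsOf ⁻¹' A) x)) :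
    convexDist n (pointsOf x) A ≤ ENNReal.ofReal (√(∑ i, z i ^ 2)) := by
  refine iSup₂_le fun α hα => ?_
  set q := normSq α (pointsOf x) with hq
  set N : ℕ := ∑ i, Sum.elim (fun _ => 0) (fun _ => 1) (x i) with hN
  have hNn : n - totalMass (pointsOf x) = N := by
    have := totalMass_pointsOf_add x
    omega
  -- Chosen so that `q + N b² = 1` when `N > 0`; for `N = 0` division by zero gives `b = 0`.
  set b : ℝ := √((1 - q) / N) with hb
  set a : Fin n → ℝ := fun i => Sum.elim (fun e => (α e : ℝ)) (fun _ => b) (x i) with ha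
  have hq1 : (q : ℝ) ≤ 1 := by exact_mod_cast hα
  have hsq : ∑ i, a i ^ 2 ≤ 1 := by
    have h1 : ∑ i, a i ^ 2 = (q : ℝ) + N * b ^ 2 := by
      rw [hq, normSq, pointIntegral_pointsOf, hN]
      push_cast
      rw [Finset.sum_mul, ← Finset.sum_add_distrib]
      refine Finset.sum_congr rfl fun i _ => ?_
      cases hx : x i <;> simp [ha, hx]
    rw [h1, hb, Real.sq_sqrt (div_nonneg (by linarith) (Nat.cast_nonneg _))]
    rcases Nat.eq_zero_or_pos N with h0 | h0
    · simp [h0, hq1]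
    · have : (0 : ℝ) < N := by exact_mod_cast h0
      field_simp
      linarith
  obtain ⟨u, hu, hle⟩ := exists_mem_sum_le_of_mem_indicatorHull hz a
  obtain ⟨y, hy⟩ := nonempty_of_measure_ne_zero hu
  refine (iInf₂_le (pointsOf (mix u x y)) hy).trans ?_
  have hcs : ∑ i, a i * z i ≤ √(∑ i, z i ^ 2) :=
    (Real.sum_mul_le_sqrt_mul_sqrt _ _ _).trans
      (mul_le_of_le_one_left (Real.sqrt_nonneg _) (Real.sqrt_le_one.2 hsq))
  refine le_trans ?_ (ENNReal.ofReal_le_ofReal (hle.trans hcs))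
  set M : ℕ := ∑ i, if u i then Sum.elim (fun _ => 0) (fun _ => 1) (x i) else 0 with hM
  set S : ℝ≥0 := ∑ i, if u i then Sum.elim α (fun _ => 0) (x i) else 0 with hS
  have hMN : M ≤ N := Finset.sum_le_sum fun i _ => by split_ifs <;> simp
  have hsum : (∑ i, if u i then a i else 0) = (S : ℝ) + M * b := by
    rw [hS, hM]
    push_cast
    rw [Finset.sum_mul, ← Finset.sum_add_distrib]
    refine Finset.sum_congr rfl fun i _ => ?_
    by_cases hui : u i <;> cases hx : x i <;> simp [ha, hx, hui]
  rw [hsum, ENNReal.ofReal_add (by positivity) (by positivity), ENNReal.ofReal_coe_nnreal, hNn]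
  refine add_le_add (by exact_mod_cast pointIntegral_diff_mix_le α u x y) ?_
  calc _ ≤ (M : ℝ≥0∞) / (N : ℝ≥0∞) ^ (1 / 2 : ℝ) * ((1 - q : ℝ≥0) : ℝ≥0∞) ^ (1 / 2 : ℝ) := by
        gcongr
        exact_mod_cast totalMass_mix_sub_le u x y
    _ ≤ _ := by
      rcases Nat.eq_zero_or_pos N with h0 | h0
      -- Without extra symbols no mass can be gained, so the quotient is `0 / 0 = 0`.
      · have : M = 0 := by omega
        simp [this]
      · have hNp : (0 : ℝ) < N := by exact_mod_cast h0
        rw [← ENNReal.ofReal_natCast M, ← ENNReal.ofReal_natCast N, ← ENNReal.ofReal_coe_nnreal,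
          ENNReal.ofReal_rpow_of_pos hNp,
          ENNReal.ofReal_rpow_of_nonneg (NNReal.coe_nonneg _) (by norm_num),
          ← ENNReal.ofReal_div_of_pos (by positivity), ← ENNReal.ofReal_mul (by positivity),
          hb, NNReal.coe_sub hα, ← Real.sqrt_eq_rpow, ← Real.sqrt_eq_rpow,
          Real.sqrt_div (by simpa using hq1)]
        refine ENNReal.ofReal_le_ofReal (le_of_eq ?_)
        rw [NNReal.coe_one]
        ring

end ConvexDistance

/-! ### Counting words with a given content. -/

namespace ConvexDistance

open PointProcess

/-- Compare the coefficients of `X ^ d` in two expansions of `(∑ X_a) ^ n`, over words and by the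
multinomial theorem. -/
lemma card_fiber_eq_multinomial {α : Type*} [Fintype α] [DecidableEq α] {n : ℕ} (d : α → ℕ)
    (hd : ∑ a, d a = n) :
    (Finset.univ.filter fun v : Fin n → α =>
      ∀ a, (Finset.univ.filter fun i => v i = a).card = d a).card =
      Nat.multinomial Finset.univ d := by
  have h := (Finset.sum_pow' (Finset.univ : Finset α)
    (fun a => (MvPolynomial.X a : MvPolynomial α ℕ)) n).symm.trans
    (Finset.sum_pow_eq_sum_piAntidiag Finset.univ _ n)
  have h1 : ∀ v : Fin n → α, ∏ i, (MvPolynomial.X (v i) : MvPolynomial α ℕ) =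
      MvPolynomial.monomial (∑ i, Finsupp.single (v i) 1) 1 := fun v => by
    simp [MvPolynomial.X, MvPolynomial.monomial_sum_one]
  have h2 : ∀ k : α → ℕ, ∏ a, (MvPolynomial.X a : MvPolynomial α ℕ) ^ k a =
      MvPolynomial.monomial (Finsupp.equivFunOnFinite.symm k) 1 := fun k => by
    rw [MvPolynomial.monomial_eq, Finsupp.prod_fintype _ _ (by simp)]
    simp
  have h3 := congrArg (MvPolynomial.coeff (Finsupp.equivFunOnFinite.symm d)) h
  simp only [h1, h2, MvPolynomial.coeff_sum, Fintype.piFinset_univ, MvPolynomial.coeff_monomial] at h3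
  have h4 : ∀ k : α → ℕ, MvPolynomial.coeff (Finsupp.equivFunOnFinite.symm d)
      ((Nat.multinomial Finset.univ k : MvPolynomial α ℕ) *
        MvPolynomial.monomial (Finsupp.equivFunOnFinite.symm k) 1) =
      if k = d then Nat.multinomial Finset.univ k else 0 := fun k => by
    rw [← map_natCast MvPolynomial.C, MvPolynomial.coeff_C_mul, MvPolynomial.coeff_monomial]
    simp
  simp only [h4] at h3
  rw [Finset.sum_ite_eq' , if_pos (by simp [Finset.mem_piAntidiag, hd])] at h3
  rw [← h3, Finset.card_filter]
  refine Finset.sum_congr rfl fun v _ => if_congr ?_ rfl rfl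
  simp [DFunLike.ext_iff, Finsupp.finsetSum_apply, Finsupp.single_apply]

lemma multinomial_sum_unit {α : Type*} [Fintype α] (d : α ⊕ Unit → ℕ) :
    Nat.multinomial Finset.univ d =
      (∑ a, d a).choose (∑ a, d (Sum.inl a)) * Nat.multinomial Finset.univ (d ∘ Sum.inl) := by
  have h1 := Nat.multinomial_spec Finset.univ d
  have h2 := Nat.multinomial_spec Finset.univ (d ∘ Sum.inl)
  have hs : ∑ a, d a = (∑ a, d (Sum.inl a)) + d (Sum.inr ()) := by simp
  have h3 := Nat.add_choose_mul_factorial_mul_factorial (∑ a, d (Sum.inl a)) (d (Sum.inr ()))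
  rw [Fintype.prod_sum_type] at h1
  simp only [Finset.univ_unique, Finset.prod_singleton, PUnit.default_eq_unit] at h1
  simp only [Function.comp_apply] at h2
  rw [← Nat.choose_symm_add, ← hs, ← h1, ← h2] at h3
  have hpos : 0 < (∏ a, (d (Sum.inl a)).factorial) * (d (Sum.inr ())).factorial := by positivity
  refine Nat.eq_of_mul_eq_mul_left hpos ?_
  rw [← h3]
  ring

lemma count_pointsOf {E : Type*} [DecidableEq E] {n : ℕ} (x : Fin n → E ⊕ Unit) (e : E) :
    (pointsOf x).count e = (Finset.univ.filter fun i => x i = Sum.inl e).card := by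
  rw [pointsOf, Multiset.count_sum', Finset.card_filter]
  refine Finset.sum_congr rfl fun i _ => ?_
  cases x i <;> simp [Multiset.count_singleton, eq_comm]

lemma card_inr_eq {E : Type*} [DecidableEq E] {n : ℕ} (x : Fin n → E ⊕ Unit) :
    (Finset.univ.filter fun i => x i = Sum.inr ()).card = n - totalMass (pointsOf x) := by
  have h := totalMass_pointsOf_add x
  rw [Finset.card_filter]
  have : ∀ i, (if x i = Sum.inr () then 1 else 0) =
      Sum.elim (fun _ : E => 0) (fun _ : Unit => 1) (x i) := fun i => by cases x i <;> simp
  simp only [this]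
  omega

lemma totalMass_pointsOf_le {E : Type*} {n : ℕ} (x : Fin n → E ⊕ Unit) :
    totalMass (pointsOf x) ≤ n :=
  (Nat.le_add_right _ _).trans (totalMass_pointsOf_add x).le

lemma pointsOf_map {E J : Type*} {n : ℕ} (c : E → J) (x : Fin n → E ⊕ Unit) :
    pointsOf (fun i => Sum.map c id (x i)) = (pointsOf x).map c := by
  rw [pointsOf, pointsOf, ← Multiset.coe_mapAddMonoidHom, map_sum]
  refine Finset.sum_congr rfl fun i _ => ?_
  cases x i <;> simp

/-- Every symbol occurs equally often in both words, the extra one because the length is fixed;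
match the fibres. -/
lemma exists_perm_of_pointsOf_eq {E : Type*} {n : ℕ} {x y : Fin n → E ⊕ Unit}
    (h : pointsOf x = pointsOf y) : ∃ σ : Equiv.Perm (Fin n), ∀ i, y (σ i) = x i := by
  classical
  have hc : ∀ j, Fintype.card {i // x i = j} = Fintype.card {i // y i = j} := by
    intro j
    rw [Fintype.card_subtype, Fintype.card_subtype]
    rcases j with e | ⟨⟩
    · rw [← count_pointsOf, ← count_pointsOf, h]
    · rw [card_inr_eq, card_inr_eq, h]
  exact ⟨Equiv.ofFiberEquiv fun j => Fintype.equivOfCardEq (hc j),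
    fun i => Equiv.ofFiberEquiv_map _ i⟩

lemma exists_pointsOf_eq {E : Type*} {n : ℕ} {ξ : CountingMeasure E} (h : totalMass ξ ≤ n) :
    ∃ x : Fin n → E ⊕ Unit, pointsOf x = ξ := by
  obtain ⟨l, hl⟩ : ∃ l : List (E ⊕ Unit), (l : Multiset (E ⊕ Unit)) =
      Multiset.map Sum.inl ξ + Multiset.replicate (n - totalMass ξ) (Sum.inr ()) :=
    ⟨_, Multiset.coe_toList _⟩
  have hlen : l.length = n := by
    have := congrArg Multiset.card hl
    simp only [Multiset.coe_card, Multiset.card_add, Multiset.card_map,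
      Multiset.card_replicate] at this
    rw [this]
    unfold totalMass at h ⊢
    omega
  subst hlen
  refine ⟨l.get, ?_⟩
  have : pointsOf l.get =
      ((Finset.univ.val.map l.get).map (Sum.elim (fun e => {e}) (fun _ => 0))).sum := by
    rw [Multiset.map_map]; rfl
  rw [this, Fin.univ_val_map, List.ofFn_get]
  rw [hl, Multiset.map_add, Multiset.sum_add, Multiset.map_map, Multiset.map_replicate]
  simp [Multiset.sum_map_singleton]

/-- The multinomial formula for a sum over all words with a given content. -/
lemma sum_prod_pointsOf_eq {k n : ℕ} (p : Fin k ⊕ Unit → ℝ) (m : CountingMeasure (Fin k))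
    [DecidablePred fun v : Fin n → Fin k ⊕ Unit => pointsOf v = m] :
    (∑ v : Fin n → Fin k ⊕ Unit with pointsOf v = m, ∏ i, p (v i)) =
      (n.choose (∑ j, m.count j) * Nat.multinomial Finset.univ (fun j => m.count j) : ℕ) *
        (∏ j, p (Sum.inl j) ^ m.count j) * p (Sum.inr ()) ^ (n - ∑ j, m.count j) := by
  have hcard : ∑ j, m.count j = totalMass m := Multiset.sum_count_eq_card (by simp)
  rw [hcard]
  by_cases hm : totalMass m ≤ n
  swap
  · rw [Nat.choose_eq_zero_of_lt (not_le.1 hm), Finset.sum_eq_zero]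
    · simp
    · intro v hv
      rw [Finset.mem_filter] at hv
      exact absurd (hv.2 ▸ totalMass_pointsOf_le v) hm
  set d : Fin k ⊕ Unit → ℕ := Sum.elim (fun j => m.count j) (fun _ => n - totalMass m) with hd
  have hdn : ∑ a, d a = n := by
    simp [hd, hcard]
    omega
  have hiff : ∀ v : Fin n → Fin k ⊕ Unit, pointsOf v = m ↔
      ∀ a, (Finset.univ.filter fun i => v i = a).card = d a := by
    intro v
    constructor
    · rintro rfl (j | ⟨⟩)
      · rw [← count_pointsOf]; rfl
      · rw [card_inr_eq]; rfl
    · intro h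
      ext j
      rw [count_pointsOf, h]; rfl
  have hmul := multinomial_sum_unit d
  rw [hdn] at hmul
  simp only [hd, Sum.elim_inl, hcard, Sum.elim_comp_inl] at hmul
  rw [← hmul, ← hd, ← card_fiber_eq_multinomial d hdn, mul_assoc]
  simp only [hiff]
  rw [← nsmul_eq_mul]
  refine Finset.sum_eq_card_nsmul fun v hv => ?_
  rw [Finset.mem_filter] at hv
  rw [← Finset.prod_fiberwise Finset.univ v]
  have : ∀ a, ∏ i with v i = a, p (v i) = p a ^ d a := fun a => by
    rw [← hv.2 a]
    exact Finset.prod_eq_pow_card fun i hi => by rw [(Finset.mem_filter.1 hi).2]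
  simp [this, hd]

end ConvexDistance

/-! ### The law of a binomial process. -/

namespace ConvexDistance

open PointProcess

lemma mass_pointsOf {E : Type*} {n : ℕ} (x : Fin n → E ⊕ Unit) (B : Set E) :
    mass (pointsOf x) B = ∑ i, (Sum.inl '' B).indicator (fun _ => 1) (x i) := by
  classical
  rw [mass, pointsOf, ← Multiset.coe_countPAddMonoidHom, map_sum]
  refine Finset.sum_congr rfl fun i _ => ?_
  cases x i with
  | inl e => by_cases h : e ∈ B <;> simp [h, Set.indicator, Multiset.countP_eq_card_filter,
      Multiset.filter_singleton]
  | inr _ => simp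

lemma mass_map {E J : Type*} (c : E → J) (ξ : CountingMeasure E) (B : Set J) :
    mass (ξ.map c) B = mass ξ (c ⁻¹' B) := by
  classical
  rw [mass, mass, Multiset.countP_map, Multiset.countP_eq_card_filter]
  rfl

lemma mass_singleton {J : Type*} [DecidableEq J] (ξ : CountingMeasure J) (j : J) :
    mass ξ {j} = ξ.count j := by
  rw [mass, Multiset.count]
  convert! Multiset.countP_congr (s := ξ) rfl fun x _ => ?_ using 1
  simp [eq_comm]

instance measurableSingletonClass_sum {α β : Type*} [MeasurableSpace α] [MeasurableSpace β]
    [MeasurableSingletonClass α] [MeasurableSingletonClass β] :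
    MeasurableSingletonClass (α ⊕ β) := ⟨by
  rintro (a | b)
  · rw [← Set.image_singleton]
    exact (measurableSet_singleton a).inl_image
  · rw [← Set.image_singleton]
    exact measurableSet_inr_image.2 (measurableSet_singleton b)⟩

variable {E : Type*} [MeasurableSpace E]

lemma measurable_mass {B : Set E} (hB : MeasurableSet B) :
    Measurable fun ξ : CountingMeasure E => mass ξ B :=
  Measurable.of_comap_le (le_iSup₂_of_le B hB le_rfl)

lemma measurable_of_mass {Z : Type*} [MeasurableSpace Z] {f : Z → CountingMeasure E}
    (h : ∀ B, MeasurableSet B → Measurable fun z => mass (f z) B) : Measurable f := by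
  refine Measurable.of_le_map ?_
  refine iSup₂_le fun B hB => ?_
  rw [← measurable_iff_le_map]
  rintro _ ⟨V, -, rfl⟩
  exact h B hB trivial

lemma measurable_pointsOf {n : ℕ} :
    Measurable (pointsOf : (Fin n → E ⊕ Unit) → CountingMeasure E) := by
  refine measurable_of_mass fun B hB => ?_
  simp only [mass_pointsOf]
  refine Finset.measurable_sum _ fun i _ => ?_
  exact (measurable_const.indicator (measurableSet_inl_image.2 hB)).comp (measurable_pi_apply i)

lemma measurable_map {J : Type*} [MeasurableSpace J] {c : E → J} (hc : Measurable c) :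
    Measurable (Multiset.map c : CountingMeasure E → CountingMeasure J) :=
  measurable_of_mass fun B hB => by
    simp only [mass_map]
    exact measurable_mass (hc hB)

instance discreteMeasurableSpace_countingMeasure {J : Type*} [Countable J] [MeasurableSpace J]
    [MeasurableSingletonClass J] : DiscreteMeasurableSpace (CountingMeasure J) := by
  classical
  have : MeasurableSingletonClass (CountingMeasure J) := ⟨fun m => by
    have : ({m} : Set (CountingMeasure J)) = ⋂ j, (fun ξ => mass ξ {j}) ⁻¹' {m.count j} := by
      ext ξ
      simp [Multiset.ext, mass_singleton]
    rw [this]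
    exact MeasurableSet.iInter fun j =>
      measurable_mass (measurableSet_singleton j) (measurableSet_singleton _)⟩
  infer_instance

/-- A random point of `E` with law `μ`, discarded with probability `1 - t`. -/
noncomputable def thinned (t : ℝ) (μ : Measure E) : Measure (E ⊕ Unit) :=
  ENNReal.ofReal t • μ.map Sum.inl + ENNReal.ofReal (1 - t) • Measure.dirac (Sum.inr ())

lemma isProbabilityMeasure_thinned {t : ℝ} (ht0 : 0 ≤ t) (ht1 : t ≤ 1) (μ : Measure E)
    [IsProbabilityMeasure μ] : IsProbabilityMeasure (thinned t μ) := by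
  have : IsProbabilityMeasure (μ.map (Sum.inl : E → E ⊕ Unit)) :=
    Measure.isProbabilityMeasure_map measurable_inl.aemeasurable
  refine ⟨?_⟩
  rw [thinned, Measure.add_apply, Measure.smul_apply, Measure.smul_apply, measure_univ,
    measure_univ, smul_eq_mul, smul_eq_mul, mul_one, mul_one,
    ← ENNReal.ofReal_add ht0 (by linarith)]
  simp

lemma thinned_real_inl {t : ℝ} (ht0 : 0 ≤ t) (μ : Measure E) {J : Type*} [MeasurableSpace J]
    [MeasurableSingletonClass J] {c : E → J} (hc : Measurable c) (j : J) :
    ((thinned t μ).map (Sum.map c (id : Unit → Unit))).real {Sum.inl j} =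
      t * μ.real (c ⁻¹' {j}) := by
  have hs : MeasurableSet ({Sum.inl j} : Set (J ⊕ Unit)) := measurableSet_singleton _
  have hm : Measurable (Sum.map c (id : Unit → Unit)) := hc.sumMap measurable_id
  rw [measureReal_def, Measure.map_apply hm hs, thinned, Measure.add_apply, Measure.smul_apply,
    Measure.smul_apply, Measure.map_apply measurable_inl (hm hs), Measure.dirac_apply' _ (hm hs)]
  have : Sum.inl ⁻¹' (Sum.map c (id : Unit → Unit) ⁻¹' {Sum.inl j}) = c ⁻¹' {j} := by
    ext; simp
  rw [this]
  simp [ENNReal.toReal_mul, ht0, measureReal_def]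

lemma thinned_real_inr {t : ℝ} (ht1 : t ≤ 1) (μ : Measure E) {J : Type*} [MeasurableSpace J]
    [MeasurableSingletonClass J] {c : E → J} (hc : Measurable c) :
    ((thinned t μ).map (Sum.map c (id : Unit → Unit))).real {Sum.inr ()} = 1 - t := by
  have hs : MeasurableSet ({Sum.inr ()} : Set (J ⊕ Unit)) := measurableSet_singleton _
  have hm : Measurable (Sum.map c (id : Unit → Unit)) := hc.sumMap measurable_id
  rw [measureReal_def, Measure.map_apply hm hs, thinned, Measure.add_apply, Measure.smul_apply,
    Measure.smul_apply, Measure.map_apply measurable_inl (hm hs), Measure.dirac_apply' _ (hm hs)]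
  have : Sum.inl ⁻¹' (Sum.map c (id : Unit → Unit) ⁻¹' {Sum.inr ()}) = ∅ := by
    ext; simp
  rw [this]
  simp [ht1]

section Law

variable {Ω : Type*} [MeasurableSpace Ω] {P : Measure Ω}
  {μ : Measure E} [IsProbabilityMeasure μ] {t : ℝ} {n : ℕ}

lemma pi_thinned_real_map_eq (ht0 : 0 ≤ t) (ht1 : t ≤ 1) {k : ℕ} {c : E → Fin k}
    (hc : Measurable c) (m : CountingMeasure (Fin k)) :
    (Measure.pi fun _ : Fin n => thinned t μ).real {x | (pointsOf x).map c = m} =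
      (n.choose (∑ j, m.count j) * Nat.multinomial Finset.univ (fun j => m.count j) : ℕ) *
        (∏ j, (t * μ.real (c ⁻¹' {j})) ^ m.count j) * (1 - t) ^ (n - ∑ j, m.count j) := by
  classical
  have := isProbabilityMeasure_thinned ht0 ht1 μ
  have hm : Measurable (Sum.map c (id : Unit → Unit)) := hc.sumMap measurable_id
  have : IsProbabilityMeasure ((thinned t μ).map (Sum.map c (id : Unit → Unit))) :=
    Measure.isProbabilityMeasure_map hm.aemeasurable
  have hmp := measurePreserving_pi (fun _ : Fin n => thinned t μ)
    (fun _ => (thinned t μ).map (Sum.map c (id : Unit → Unit))) fun _ => hm.measurePreserving _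
  have hset : {x : Fin n → E ⊕ Unit | (pointsOf x).map c = m} =
      (fun x i => Sum.map c id (x i)) ⁻¹'
        ((Finset.univ.filter fun v : Fin n → Fin k ⊕ Unit => pointsOf v = m :
          Finset (Fin n → Fin k ⊕ Unit)) : Set (Fin n → Fin k ⊕ Unit)) := by
    ext x
    simp [pointsOf_map]
  rw [hset, measureReal_def, hmp.measure_preimage (Set.toFinite _).measurableSet.nullMeasurableSet,
    ← measureReal_def, ← sum_measureReal_singleton]
  have h1 : ∀ v : Fin n → Fin k ⊕ Unit,
      (Measure.pi fun _ => (thinned t μ).map (Sum.map c (id : Unit → Unit))).real {v} =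
        ∏ i, ((thinned t μ).map (Sum.map c (id : Unit → Unit))).real {v i} := fun v => by
    rw [measureReal_def, Measure.pi_singleton, ENNReal.toReal_prod]
    rfl
  simp only [h1]
  rw [sum_prod_pointsOf_eq
    (fun a => ((thinned t μ).map (Sum.map c (id : Unit → Unit))).real {a}) m]
  simp only [thinned_real_inl ht0 μ hc, thinned_real_inr ht1 μ hc]

lemma sum_real_fiber {k : ℕ} {c : E → Fin k} (hc : Measurable c) :
    ∑ j, μ.real (c ⁻¹' {j}) = 1 := by
  have := Measure.isProbabilityMeasure_map (μ := μ) hc.aemeasurable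
  have h : ∑ j, (μ.map c).real {j} = 1 := by
    rw [sum_measureReal_singleton]
    simp
  rw [← h]
  exact Finset.sum_congr rfl fun j _ => (map_measureReal_apply hc (measurableSet_singleton j)).symm

lemma real_map_eq {ξ : Ω → CountingMeasure E} (hξ : IsBinomialPointProcess P ξ n t μ) {k : ℕ}
    {c : E → Fin k} (hc : Measurable c) (m : CountingMeasure (Fin k)) :
    P.real {ω | (ξ ω).map c = m} =
      (n.choose (∑ j, m.count j) * Nat.multinomial Finset.univ (fun j => m.count j) : ℕ) *
        (∏ j, (t * μ.real (c ⁻¹' {j})) ^ m.count j) * (1 - t) ^ (n - ∑ j, m.count j) := by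
  have h := hξ.multinomial k (fun j => c ⁻¹' {j}) (fun j => hc (measurableSet_singleton j))
    (fun i j hij => Disjoint.preimage _ (by simpa using hij)) (fun j => m.count j)
  rw [← Finset.mul_sum, sum_real_fiber hc, mul_one] at h
  rw [← h]
  congr 1
  ext ω
  simp [Multiset.ext, ← mass_map, mass_singleton]

/-- A binomial point process is distributed as `n` independent thinned points. -/
theorem map_eq_map_pointsOf [IsProbabilityMeasure P] (ht0 : 0 ≤ t) (ht1 : t ≤ 1) {ξ : Ω → CountingMeasure E}
    (hξ : IsBinomialPointProcess P ξ n t μ) :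
    P.map ξ = (Measure.pi fun _ : Fin n => thinned t μ).map pointsOf := by
  have := isProbabilityMeasure_thinned ht0 ht1 μ
  have := Measure.isProbabilityMeasure_map (μ := P) hξ.measurable.aemeasurable
  have := Measure.isProbabilityMeasure_map (μ := Measure.pi fun _ : Fin n => thinned t μ)
    (measurable_pointsOf (E := E)).aemeasurable
  have hmap : ∀ {k : ℕ} {c : E → Fin k}, Measurable c → (P.map ξ).map (Multiset.map c) =
      ((Measure.pi fun _ : Fin n => thinned t μ).map pointsOf).map (Multiset.map c) := by
    intro k c hc
    rw [Measure.map_map (measurable_map hc) hξ.measurable,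
      Measure.map_map (measurable_map hc) measurable_pointsOf]
    refine Measure.ext_of_singleton fun m => ?_
    rw [Measure.map_apply ((measurable_map hc).comp hξ.measurable) (measurableSet_singleton m),
      Measure.map_apply ((measurable_map hc).comp measurable_pointsOf) (measurableSet_singleton m),
      ← ENNReal.toReal_eq_toReal_iff' (measure_ne_top _ _) (measure_ne_top _ _)]
    exact (real_map_eq hξ hc m).trans (pi_thinned_real_map_eq ht0 ht1 hc m).symm
  -- Finite intersections of conditions on single masses form a generating π-system.
  refine ext_of_generate_finite _
    (generateFrom_piiUnionInter_measurableSet (fun B : Set E =>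
      MeasurableSpace.comap (fun ξ : CountingMeasure E => mass ξ B) ⊤) {B | MeasurableSet B}).symm
    (isPiSystem_piiUnionInter _ (fun B => @MeasurableSpace.isPiSystem_measurableSet _ (_)) _)
    ?_ (by simp)
  rintro s ⟨T, hT, f, hf, rfl⟩
  classical
  -- Colour each point by which of the finitely many test sets contain it. The event depends only on
  -- the coloured process, where the laws agree by `hmap`.
  let e := Fintype.equivFin (T → Bool)
  let c : E → Fin (Fintype.card (T → Bool)) := fun x => e fun B => decide (x ∈ B.1)
  have hc : Measurable c := by
    refine (measurable_of_finite e).comp (measurable_pi_iff.2 fun B => ?_)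
    refine measurable_to_bool ?_
    have : (fun x => decide (x ∈ B.1)) ⁻¹' {true} = B.1 := by ext; simp
    rw [this]
    exact hT B.2
  have hmass : ∀ B (hB : B ∈ T) (η : CountingMeasure E),
      mass η B = mass (η.map c) {j | e.symm j ⟨B, hB⟩ = true} := by
    intro B hB η
    rw [mass_map]
    congr 1
    ext x
    simp [c]
  choose! V hV hVf using hf
  have hset : ⋂ B ∈ T, f B = Multiset.map c ⁻¹'
      {m | ∀ B (hB : B ∈ T), mass m {j | e.symm j ⟨B, hB⟩ = true} ∈ V B} := by
    ext η
    simp only [Set.mem_iInter, Set.mem_preimage, Set.mem_ofPred_eq]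
    refine forall₂_congr fun B hB => ?_
    rw [← hVf B hB, Set.mem_preimage, hmass B hB]
  rw [hset, ← Measure.map_apply (measurable_map hc) (MeasurableSet.of_discrete),
    ← Measure.map_apply (measurable_map hc) (MeasurableSet.of_discrete), hmap hc]

end Law

end ConvexDistance

/-! ### Measurable control of all orderings of a point set. -/

namespace ConvexDistance

open PointProcess

open Classical in
/-- The counting measure on the orderings of a point set with at most `n` points, as sequences of
length `n` filled up with an extra symbol. -/
noncomputable def orderings {E : Type*} [MeasurableSpace E] (n : ℕ) (ξ : CountingMeasure E) :
    Measure (Fin n → E ⊕ Unit) :=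
  if h : totalMass ξ ≤ n then
    ∑ π : Equiv.Perm (Fin n), Measure.dirac fun i => (exists_pointsOf_eq h).choose (π i)
  else 0

variable {E : Type*} [MeasurableSpace E] {n : ℕ}

lemma orderings_pointsOf (x : Fin n → E ⊕ Unit) :
    orderings n (pointsOf x) = ∑ π : Equiv.Perm (Fin n), Measure.dirac fun i => x (π i) := by
  have h := totalMass_pointsOf_le x
  rw [orderings, dif_pos h]
  obtain ⟨σ, hσ⟩ := exists_perm_of_pointsOf_eq (exists_pointsOf_eq h).choose_spec
  refine Fintype.sum_equiv (Equiv.mulLeft σ) _ _ fun π => ?_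
  congr 1
  funext i
  exact (hσ (π i)).symm

instance isFiniteMeasure_orderings (ξ : CountingMeasure E) : IsFiniteMeasure (orderings n ξ) := by
  unfold orderings
  split_ifs
  · refine ⟨?_⟩
    rw [Measure.finsetSum_apply]
    simp
  · infer_instance

lemma orderings_pi_eq {h : Fin n → Set (E ⊕ Unit)} (hh : ∀ i, MeasurableSet (h i))
    {J : Type*} (c : E → J)
    (hc : ∀ e e', c e = c e' → ∀ i, Sum.inl e ∈ h i ↔ Sum.inl e' ∈ h i)
    {ξ ξ' : CountingMeasure E} (heq : ξ.map c = ξ'.map c) :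
    orderings n ξ (Set.univ.pi h) = orderings n ξ' (Set.univ.pi h) := by
  have hcard : totalMass ξ = totalMass ξ' := by
    simpa [totalMass] using congrArg Multiset.card heq
  by_cases hn : totalMass ξ ≤ n
  swap
  · rw [orderings, orderings, dif_neg hn, dif_neg (hcard ▸ hn)]
  obtain ⟨x, rfl⟩ := exists_pointsOf_eq hn
  obtain ⟨x', rfl⟩ := exists_pointsOf_eq (hcard ▸ hn : totalMass ξ' ≤ n)
  rw [← pointsOf_map, ← pointsOf_map] at heq
  obtain ⟨σ, hσ⟩ := exists_perm_of_pointsOf_eq heq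
  have hH : MeasurableSet (Set.univ.pi h) := MeasurableSet.univ_pi hh
  rw [orderings_pointsOf, orderings_pointsOf, Measure.finsetSum_apply, Measure.finsetSum_apply]
  refine Fintype.sum_equiv (Equiv.mulLeft σ) _ _ fun π => ?_
  rw [Measure.dirac_apply' _ hH, Measure.dirac_apply' _ hH]
  have hiff : ∀ i j, x j ∈ h i ↔ x' (σ j) ∈ h i := by
    intro i j
    have := hσ j
    cases hx : x j <;> cases hx' : x' (σ j) <;> simp only [hx, hx', Sum.map_inl, Sum.map_inr,
      reduceCtorEq, Sum.inl.injEq] at this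
    · exact (hc _ _ this i).symm
    · rfl
  have : (fun i => x (π i)) ∈ Set.univ.pi h ↔
      (fun i => x' ((Equiv.mulLeft σ) π i)) ∈ Set.univ.pi h := by
    simp only [Set.mem_univ_pi]
    exact forall_congr' fun i => hiff i (π i)
  classical
  simp only [Set.indicator_apply, this, Pi.one_apply]

/-- On a box the value depends only on the points coloured by the sides containing them
(`orderings_pi_eq`). It therefore factors through counting measures on a finite set, where every
function is measurable. Boxes generate the product σ-algebra. -/
lemma measurable_orderings :
    Measurable (orderings n : CountingMeasure E → Measure (Fin n → E ⊕ Unit)) := by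
  classical
  have hpi : ∀ h : Fin n → Set (E ⊕ Unit), (∀ i, MeasurableSet (h i)) →
      Measurable fun ξ : CountingMeasure E => orderings n ξ (Set.univ.pi h) := by
    intro h hh
    let c : E → Fin n → Bool := fun e i => decide (Sum.inl e ∈ h i)
    have hc : Measurable c := by
      refine measurable_pi_iff.2 fun i => measurable_to_bool ?_
      have : (fun e => c e i) ⁻¹' {true} = Sum.inl ⁻¹' h i := by ext; simp [c]
      rw [this]
      exact measurable_inl (hh i)
    have hf : Function.FactorsThrough
        (fun ξ : CountingMeasure E => orderings n ξ (Set.univ.pi h)) (Multiset.map c) :=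
      fun ξ ξ' heq => orderings_pi_eq hh c
        (fun e e' hee i => by simpa [c] using congrFun hee i) heq
    rw [← hf.extend_comp fun _ => 0]
    exact (Measurable.of_discrete).comp (measurable_map hc)
  refine Measurable.measure_of_isPiSystem generateFrom_pi.symm isPiSystem_pi ?_ ?_
  · rintro _ ⟨h, hh, rfl⟩
    exact hpi h fun i => hh i (Set.mem_univ i)
  · simpa using hpi (fun _ => Set.univ) fun _ => MeasurableSet.univ

lemma mem_of_orderings_compl_eq_zero {G : Set (Fin n → E ⊕ Unit)} (hG : MeasurableSet G)
    {x : Fin n → E ⊕ Unit} (h : orderings n (pointsOf x) Gᶜ = 0) : x ∈ G := by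
  rw [orderings_pointsOf, Measure.finsetSum_apply, Finset.sum_eq_zero_iff] at h
  have := h 1 (Finset.mem_univ _)
  rw [Measure.dirac_apply' _ hG.compl] at this
  by_contra hx
  simp [hx] at this

lemma orderings_compl_eq_zero {G : Set (Fin n → E ⊕ Unit)} (hG : MeasurableSet G)
    {ξ : CountingMeasure E} (h : ∀ x : Fin n → E ⊕ Unit, pointsOf x = ξ → x ∈ G) :
    orderings n ξ Gᶜ = 0 := by
  by_cases hn : totalMass ξ ≤ n
  · obtain ⟨x, rfl⟩ := exists_pointsOf_eq hn
    rw [orderings_pointsOf, Measure.finsetSum_apply, Finset.sum_eq_zero]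
    intro π _
    rw [Measure.dirac_apply' _ hG.compl, Set.indicator_of_notMem]
    refine fun hx => hx (h _ ?_)
    exact Fintype.sum_equiv π _ _ fun i => rfl
  · simp [orderings, hn]

lemma le_expDist_of_notMem_parallelSet (ρ : Measure (E ⊕ Unit)) {A : Set (CountingMeasure E)}
    {s : ℝ} (hs : 0 ≤ s) {x : Fin n → E ⊕ Unit} (hx : pointsOf x ∉ parallelSet n A s) :
    ENNReal.ofReal (Real.exp (s ^ 2 / 4)) ≤ expDist (resampleSets ρ (pointsOf ⁻¹' A) x) := by
  refine le_iInf₂ fun z hz => ENNReal.ofReal_le_ofReal (Real.exp_le_exp.2 ?_)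
  have h1 : s < √(∑ i, z i ^ 2) :=
    (ENNReal.ofReal_lt_ofReal_iff_of_nonneg hs).1
      ((not_le.1 hx).trans_le (convexDist_pointsOf_le ρ A x hz))
  have h2 := (Real.lt_sqrt hs).1 h1
  linarith

end ConvexDistance

/-! ### Conclusion by Markov's inequality. -/

open ConvexDistance

theorem theorem3 {E : Type*} [MeasurableSpace E] (μ : Measure E) [IsProbabilityMeasure μ]
    (t : ℝ) (ht0 : 0 ≤ t) (ht1 : t ≤ 1) (n : ℕ)
    {Ω : Type*} [MeasurableSpace Ω] (P : Measure Ω) [IsProbabilityMeasure P]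
    (ξ : Ω → PointProcess.CountingMeasure E)
    (hξ : PointProcess.IsBinomialPointProcess P ξ n t μ)
    (A : Set (PointProcess.CountingMeasure E)) (hA : MeasurableSet A)
    (s : ℝ) (hs : 0 ≤ s) :
    P.real {ω | ξ ω ∈ A} * P.real {ω | ξ ω ∉ PointProcess.parallelSet n A s} ≤
      Real.exp (-(s ^ 2) / 4) := by
  have := isProbabilityMeasure_thinned ht0 ht1 μ
  set ρ := thinned t μ
  set Q := Measure.pi fun _ : Fin n => ρ
  set A' : Set (Fin n → E ⊕ Unit) := pointsOf ⁻¹' A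
  have hA' : MeasurableSet A' := measurable_pointsOf hA
  have hlaw := map_eq_map_pointsOf ht0 ht1 hξ
  have hmeas : ∀ C : Set (PointProcess.CountingMeasure E), MeasurableSet C →
      P (ξ ⁻¹' C) = Q (pointsOf ⁻¹' C) := fun C hC => by
    rw [← Measure.map_apply hξ.measurable hC, hlaw, Measure.map_apply measurable_pointsOf hC]
  have hfm := measurable_expDist_resampleSets ρ hA'
  set G : Set (Fin n → E ⊕ Unit) :=
    {x | ENNReal.ofReal (Real.exp (s ^ 2 / 4)) ≤ expDist (resampleSets ρ A' x)}
  have hG : MeasurableSet G := measurableSet_le measurable_const hfm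
  -- The measurable substitute for the complement of the parallel set: `C` contains that complement,
  -- as every ordering of such a point set lies in `G`, while `pointsOf ⁻¹' C ⊆ G` by the identity
  -- permutation. Point sets with more than `n` points also belong to `C`, but `pointsOf` never
  -- produces them.
  set C : Set (PointProcess.CountingMeasure E) := {ν | orderings n ν Gᶜ = 0}
  have hC : MeasurableSet C :=
    (Measure.measurable_coe hG.compl).comp measurable_orderings (measurableSet_singleton 0)
  have hbad : P {ω | ξ ω ∉ PointProcess.parallelSet n A s} ≤ Q G := by
    refine (measure_mono (t := ξ ⁻¹' C) fun ω hω => orderings_compl_eq_zero hG ?_).trans ?_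
    · intro x hx
      refine le_expDist_of_notMem_parallelSet ρ hs ?_
      rw [hx]
      exact hω
    · rw [hmeas C hC]
      exact measure_mono fun x hx => mem_of_orderings_compl_eq_zero hG hx
  have hgood : P {ω | ξ ω ∈ A} = Q A' := hmeas A hA
  have hmarkov : ENNReal.ofReal (Real.exp (s ^ 2 / 4)) * Q G ≤ (Q A')⁻¹ :=
    (mul_meas_ge_le_lintegral hfm _).trans (lintegral_expDist_resampleSets_le ρ hA')
  have hmain : P {ω | ξ ω ∈ A} * P {ω | ξ ω ∉ PointProcess.parallelSet n A s} ≤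
      ENNReal.ofReal (Real.exp (-(s ^ 2) / 4)) := by
    rw [neg_div, Real.exp_neg, ENNReal.ofReal_inv_of_pos (Real.exp_pos _),
      ENNReal.le_inv_iff_mul_le, hgood, mul_assoc, mul_comm (P _)]
    calc _ ≤ Q A' * (ENNReal.ofReal (Real.exp (s ^ 2 / 4)) * Q G) := by gcongr
      _ ≤ Q A' * (Q A')⁻¹ := by gcongr
      _ ≤ 1 := ENNReal.mul_inv_le_one _
  rw [measureReal_def, measureReal_def, ← ENNReal.toReal_mul]
  exact ENNReal.toReal_le_of_le_ofReal (Real.exp_pos _).le hmain
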